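/- Let $\Lambda$ be the set of all pure $\lambda$-terms (open or closed, modulo $\alpha$-equivalence), and let $\to_\beta$ denote $\beta$-reduction in finitely many (possibly zero) steps. Types of Girard's system $\mathcal F$ are built from propositional variables and propositional constants (from a given set of constants) by $\to$ and $\forall X$; $\vdash_{\mathcal F} t : A$ means that the $\lambda$-term $t$ has type $A$ in the empty context in the Curry-style system $\mathcal F$ (variable, $\to$-introduction, $\to$-elimination, $\forall$-introduction, $\forall$-elimination). The classes of $\forall_2^+$ and $\forall_2^-$ types are defined simultaneously: atomic types are both; $B \to A$ is $\forall_2^+$ (resp. $\forall_2^-$) if $A$ is $\forall_2^+$ (resp. $\forall_2^-$) and $B$ is $\forall_2^-$ (resp. $\forall_2^+$); $\forall X A$ is $\forall_2^+$ if $A$ is; $\forall X A$ is $\forall_2^-$ if $A$ is and $X$ does not occur free in $A$. A type is proper if each of its subexpressions $\forall X B$ is such that $X$ occurs free in $B$. A type is closed if it has no free variable. A set $G \subseteq \Lambda$ is saturated if $u \in G$ and $t \to_\beta u$ imply $t \in G$. For $G, G' \subseteq \Lambda$ let $G \to G' = \{u \in \Lambda : (u)t \in G' \text{ for all } t \in G\}$.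 A set $R$ of saturated sets is adequate if $G, G' \in R$ implies $(G \to G') \in R$ and the intersection of every subset of $R$ is in $R$ (the empty intersection being $\Lambda$). A $\Lambda_\beta$-model $M$ consists of an adequate set $R$ of saturated sets and an element $|P|_M \in R$ for every propositional constant $P$. For an interpretation $I$ of the propositional variables in $R$, put $|X|_{M,I} = I(X)$, $|P|_{M,I} = |P|_M$, $|B \to C|_{M,I} = (|B|_{M,I} \to |C|_{M,I})$ and $|\forall X B|_{M,I} = \bigcap_{\Phi \in R} |B|_{M, I[X \leftarrow \Phi]}$. For a closed type $A$ the value does not depend on $I$ and is written $|A|_M$; let $|A|_\beta = \bigcap_M |A|_M$, the intersection over all $\Lambda_\beta$-models $M$. **Theorem.** Let $A$ be a closed, proper $\forall_2^+$ type of system $\mathcal F$ and let $t$ be a $\lambda$-term. Then $t \in |A|_\beta$ if and only if there is a $\lambda$-term $t'$ such that $t \to_\beta t'$ and $\vdash_{\mathcal F} t' : A$. -/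

import Mathlib

namespace SystemF

/-- Pure `λ`-terms modulo `α`-equivalence, in de Bruijn notation. Indices that point beyond the
enclosing abstractions are the free variables, so open terms are included. -/
inductive Tm : Type
  | var (n : ℕ) : Tm
  | app (t u : Tm) : Tm
  | lam (t : Tm) : Tm

/-- The extension of a renaming under a binder. -/
def upRen (ρ : ℕ → ℕ) : ℕ → ℕ
  | 0 => 0
  | n + 1 => ρ n + 1

namespace Tm

def rename : (ℕ → ℕ) → Tm → Tm
  | ρ, var n => var (ρ n)
  | ρ, app t u => app (rename ρ t) (rename ρ u)
  | ρ, lam t => lam (rename (upRen ρ) t)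

/-- The extension of a substitution under a binder. -/
def up (σ : ℕ → Tm) : ℕ → Tm
  | 0 => var 0
  | n + 1 => rename Nat.succ (σ n)

/-- Simultaneous capture-avoiding substitution. -/
def subst : (ℕ → Tm) → Tm → Tm
  | σ, var n => σ n
  | σ, app t u => app (subst σ t) (subst σ u)
  | σ, lam t => lam (subst (up σ) t)

/-- The substitution of `u` for the variable `0`, the other variables being lowered by one. -/
def single (u : Tm) : ℕ → Tm
  | 0 => u
  | n + 1 => var n

/-- `u[v/x]`, where `x` is the variable bound by the abstraction whose body is `u`. -/
def inst (u v : Tm) : Tm := subst (single v) u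

/-- One step of `β`-reduction, in any context. -/
inductive BetaStep : Tm → Tm → Prop
  | beta (u v : Tm) : BetaStep (app (lam u) v) (inst u v)
  | appLeft {t t' : Tm} (u : Tm) : BetaStep t t' → BetaStep (app t u) (app t' u)
  | appRight (t : Tm) {u u' : Tm} : BetaStep u u' → BetaStep (app t u) (app t u')
  | lam {t t' : Tm} : BetaStep t t' → BetaStep (Tm.lam t) (Tm.lam t')

/-- `t →_β t'`: `β`-reduction in any finite number of steps, possibly none. -/
def BetaRed : Tm → Tm → Prop := Relation.ReflTransGen BetaStep

end Tm

/-- The types of system `F` over a set `C` of propositional constants, modulo `α`-equivalence, in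
de Bruijn notation: `all A` is `∀ X A`, where `X` is the variable of index `0` in `A`. -/
inductive Ty (C : Type*)
  | var (n : ℕ) : Ty C
  | const (c : C) : Ty C
  | arr (A B : Ty C) : Ty C
  | all (A : Ty C) : Ty C

namespace Ty

variable {C : Type*}

def rename : (ℕ → ℕ) → Ty C → Ty C
  | ρ, var n => var (ρ n)
  | _, const c => const c
  | ρ, arr A B => arr (rename ρ A) (rename ρ B)
  | ρ, all A => all (rename (upRen ρ) A)

/-- The extension of a substitution under a quantifier. -/
def up (σ : ℕ → Ty C) : ℕ → Ty C
  | 0 => var 0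
  | n + 1 => rename Nat.succ (σ n)

/-- Simultaneous capture-avoiding substitution. -/
def subst : (ℕ → Ty C) → Ty C → Ty C
  | σ, var n => σ n
  | _, const c => const c
  | σ, arr A B => arr (subst σ A) (subst σ B)
  | σ, all A => all (subst (up σ) A)

/-- The substitution of `F` for the variable `0`, the other variables being lowered by one. -/
def single (F : Ty C) : ℕ → Ty C
  | 0 => F
  | n + 1 => var n

/-- `A[F/X]`, where `X` is the variable bound by the quantifier whose body is `A`. -/
def inst (A F : Ty C) : Ty C := subst (single F) A

/-- The variable of index `n` occurs free in the type. -/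
def Occurs : ℕ → Ty C → Prop
  | n, var m => n = m
  | _, const _ => False
  | n, arr A B => Occurs n A ∨ Occurs n B
  | n, all A => Occurs (n + 1) A

/-- A type without free variables. -/
def Closed (A : Ty C) : Prop := ∀ n, ¬ A.Occurs n

/-- Proper types: every quantified variable occurs in the scope of its quantifier. -/
def Proper : Ty C → Prop
  | var _ => True
  | const _ => True
  | arr A B => Proper A ∧ Proper B
  | all A => Occurs 0 A ∧ Proper A

mutual

/-- `∀₂⁺` types (types with positive quantifiers). -/
def IsForallPos : Ty C → Prop
  | var _ => True
  | const _ => True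
  | arr B A => IsForallNeg B ∧ IsForallPos A
  | all A => IsForallPos A

/-- `∀₂⁻` types (types with negative quantifiers). -/
def IsForallNeg : Ty C → Prop
  | var _ => True
  | const _ => True
  | arr B A => IsForallPos B ∧ IsForallNeg A
  | all A => ¬ Occurs 0 A ∧ IsForallNeg A

end

end Ty

section Typing

variable {C : Type*}

/-- A typing context: a partial assignment of types to the variables of the `λ`-calculus. Those
that are met in a derivation of a judgement in the empty context have finite domain. -/
abbrev Ctx (C : Type*) := ℕ → Option (Ty C)

/-- The empty context. -/
def Ctx.empty : Ctx C := fun _ => none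

/-- `Γ, x : A`, where `x` is the variable about to be bound. -/
def Ctx.cons (A : Ty C) (Γ : Ctx C) : Ctx C
  | 0 => some A
  | n + 1 => Γ n

/-- The context read in the scope of one more type variable, which is not free in it. -/
def Ctx.shift (Γ : Ctx C) : Ctx C := fun n => (Γ n).map (Ty.rename Nat.succ)

/-- The typing rules of system `F` (à la Curry); `Typing Γ t A` is `Γ ⊢_F t : A`. -/
inductive Typing : Ctx C → Tm → Ty C → Prop
  | var {Γ : Ctx C} {n : ℕ} {A : Ty C} : Γ n = some A → Typing Γ (Tm.var n) A
  | lam {Γ : Ctx C} {t : Tm} {A B : Ty C} :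
      Typing (Ctx.cons A Γ) t B → Typing Γ (Tm.lam t) (Ty.arr A B)
  | app {Γ : Ctx C} {u v : Tm} {A B : Ty C} :
      Typing Γ u (Ty.arr A B) → Typing Γ v A → Typing Γ (Tm.app u v) B
  | gen {Γ : Ctx C} {t : Tm} {A : Ty C} :
      Typing (Ctx.shift Γ) t A → Typing Γ t (Ty.all A)
  | inst {Γ : Ctx C} {t : Tm} {A : Ty C} (F : Ty C) :
      Typing Γ t (Ty.all A) → Typing Γ t (A.inst F)

end Typing

/-- `→_β`-saturated sets of `λ`-terms. -/
def IsSaturated (G : Set Tm) : Prop :=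
  ∀ t u : Tm, u ∈ G → Tm.BetaRed t u → t ∈ G

/-- `G → G'`, for sets of `λ`-terms. -/
def arrowSet (G G' : Set Tm) : Set Tm := {u | ∀ t ∈ G, Tm.app u t ∈ G'}

/-- Adequate sets of `→_β`-saturated sets (`⋂₀ ∅` is the set of all `λ`-terms). -/
structure IsAdequate (R : Set (Set Tm)) : Prop where
  saturated : ∀ G ∈ R, IsSaturated G
  arrow_mem : ∀ G ∈ R, ∀ G' ∈ R, arrowSet G G' ∈ R
  sInter_mem : ∀ σ : Set (Set Tm), σ ⊆ R → ⋂₀ σ ∈ R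

/-- The `Λ_β`-models for system `F` over the set `C` of constants: a set of truth values and the
values of the constants. -/
structure BetaModel (C : Type*) where
  R : Set (Set Tm)
  adequate : IsAdequate R
  const : C → R

/-- `I [X ← Φ]`, where `X` is the variable about to be bound. -/
def consVal {α : Type*} (a : α) (I : ℕ → α) : ℕ → α
  | 0 => a
  | n + 1 => I n

namespace Ty

variable {C : Type*}

/-- The value `|A|_{M,I}` of the type `A` in the model `M` under the interpretation `I`. -/
def val (M : BetaModel C) : (ℕ → M.R) → Ty C → Set Tm
  | I, var n => I n
  | _, const c => M.const c
  | I, arr A B => arrowSet (val M I A) (val M I B)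
  | I, all A => ⋂ Φ : M.R, val M (consVal Φ I) A

/-- The value of a type is a truth value of the model. -/
theorem val_mem (M : BetaModel C) (A : Ty C) : ∀ I : ℕ → M.R, A.val M I ∈ M.R := by
  induction A with
  | var n => intro I; exact (I n).2
  | const c => intro I; exact (M.const c).2
  | arr A B ihA ihB => intro I; exact M.adequate.arrow_mem _ (ihA I) _ (ihB I)
  | all A ih =>
    intro I
    have h := M.adequate.sInter_mem (Set.range fun Φ : M.R => val M (consVal Φ I) A)
      (by rintro _ ⟨Φ, rfl⟩; exact ih _)
    rwa [Set.sInter_range] at h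

/-- The value of a type depends only on the values of its free variables. -/
theorem val_congr (M : BetaModel C) (A : Ty C) :
    ∀ I J : ℕ → M.R, (∀ n, A.Occurs n → I n = J n) → A.val M I = A.val M J := by
  induction A with
  | var n => intro I J h; simp only [val]; rw [h n rfl]
  | const c => intro I J _; rfl
  | arr A B ihA ihB =>
    intro I J h
    simp only [val]
    rw [ihA I J fun n hn => h n (Or.inl hn), ihB I J fun n hn => h n (Or.inr hn)]
  | all A ih =>
    intro I J h
    simp only [val]
    refine Set.iInter_congr fun Φ => ih _ _ fun n hn => ?_
    cases n with
    | zero => rfl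
    | succ n => exact h n hn

/-- The value of a closed type does not depend on the interpretation. -/
theorem val_eq_of_closed (M : BetaModel C) {A : Ty C} (hA : A.Closed) (I J : ℕ → M.R) :
    A.val M I = A.val M J :=
  val_congr M A I J fun n hn => absurd hn (hA n)

/-- `|A|_β`: the intersection of the values of `A` in all `Λ_β`-models. For a closed type the
interpretation `I` plays no role, see `val_eq_of_closed`. -/
def betaVal (A : Ty C) : Set Tm :=
  ⋂ (M : BetaModel C) (I : ℕ → M.R), A.val M I

end Ty

end SystemF

namespace SystemF

-- If `t` reduces to a typable term, then `t ∈ |A|_β` because the typing rules are sound in every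
-- model (`Typing.subst_mem_val`) and values are saturated. For the converse, one model suffices.
-- Its truth values are all the saturated sets, and atoms are interpreted by the terms that reduce
-- to a neutral term of that atomic type in a context `Γ`. Here `Γ` avoids the free variables of `t`
-- and gives infinitely many variables to every proper type among the renamed subexpressions of `A`.
-- By induction on the type (`val_neutralModel`), the value of a `∀₂⁺` type contains only terms that
-- reduce to a normal term of that type, and the value of a `∀₂⁻` type contains all terms that
-- reduce to a neutral one. Arrows and positive quantifiers are handled with fresh term and type
-- variables. In a proper `∀₂⁻` type no quantifier is met in the negative role, so quantifiers are
-- never eliminated and `NormalTyping` needs no instantiation rule. Reduction creates no free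
-- variables, so the typing in `Γ` of a reduct of `t` is a typing in the empty context.

theorem upRen_comp (ρ ρ' : ℕ → ℕ) (n : ℕ) : upRen ρ (upRen ρ' n) = upRen (fun m => ρ (ρ' m)) n := by
  cases n <;> rfl

-- Renaming, substitution and reduction of terms

namespace Tm

/-- The variable of index `n` occurs free in the term. -/
def Occurs : ℕ → Tm → Prop
  | n, var m => n = m
  | n, app t u => Occurs n t ∨ Occurs n u
  | n, lam t => Occurs (n + 1) t

/-- A strict upper bound of the free variables of a term. -/
def bound : Tm → ℕ
  | var n => n + 1
  | app t u => max (bound t) (bound u)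
  | lam t => bound t

theorem Occurs.lt_bound {t : Tm} : ∀ {n : ℕ}, Occurs n t → n < bound t := by
  induction t with
  | var m => rintro n rfl; exact Nat.lt_succ_self _
  | app t u iht ihu =>
    rintro n (h | h)
    · exact lt_max_of_lt_left (iht h)
    · exact lt_max_of_lt_right (ihu h)
  | lam t ih => intro n h; exact (Nat.lt_succ_self n).trans (ih h)

theorem rename_congr (t : Tm) :
    ∀ {ρ ρ' : ℕ → ℕ}, (∀ n, Occurs n t → ρ n = ρ' n) → rename ρ t = rename ρ' t := by
  induction t with
  | var m => intro ρ ρ' h; simp only [rename, h m rfl]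
  | app t u iht ihu =>
    intro ρ ρ' h
    simp only [rename, iht fun n hn => h n (Or.inl hn), ihu fun n hn => h n (Or.inr hn)]
  | lam t ih =>
    intro ρ ρ' h
    simp only [rename]
    rw [ih]
    rintro (_ | n) hn
    · rfl
    · exact congrArg Nat.succ (h n hn)

theorem subst_congr {σ τ : ℕ → Tm} (t : Tm) (h : ∀ n, σ n = τ n) : subst σ t = subst τ t := by
  rw [funext h]

theorem up_var (n : ℕ) : up var n = var n := by
  cases n <;> rfl

theorem subst_var (t : Tm) : subst var t = t := by
  induction t with
  | var n => rfl
  | app t u iht ihu => simp only [subst, iht, ihu]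
  | lam t ih => simp only [subst]; rw [subst_congr t up_var, ih]

theorem rename_eq_subst (t : Tm) : ∀ ρ : ℕ → ℕ, rename ρ t = subst (fun n => var (ρ n)) t := by
  induction t with
  | var n => intro ρ; rfl
  | app t u iht ihu => intro ρ; simp only [rename, subst, iht, ihu]
  | lam t ih =>
    intro ρ
    simp only [rename, subst, ih]
    rw [subst_congr t]
    rintro (_ | n) <;> rfl

theorem rename_id (t : Tm) : rename (fun n => n) t = t := by
  rw [rename_eq_subst]; exact subst_var t

theorem subst_rename (t : Tm) :
    ∀ (ρ : ℕ → ℕ) (σ : ℕ → Tm), subst σ (rename ρ t) = subst (fun n => σ (ρ n)) t := by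
  induction t with
  | var n => intro ρ σ; rfl
  | app t u iht ihu => intro ρ σ; simp only [rename, subst, iht, ihu]
  | lam t ih =>
    intro ρ σ
    simp only [rename, subst, ih]
    rw [subst_congr t]
    rintro (_ | n) <;> rfl

theorem rename_rename (t : Tm) (ρ ρ' : ℕ → ℕ) :
    rename ρ (rename ρ' t) = rename (fun n => ρ (ρ' n)) t := by
  simp only [rename_eq_subst _ ρ, subst_rename, rename_eq_subst t fun n => ρ (ρ' n)]

theorem rename_subst (t : Tm) :
    ∀ (ρ : ℕ → ℕ) (σ : ℕ → Tm), rename ρ (subst σ t) = subst (fun n => rename ρ (σ n)) t := by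
  induction t with
  | var n => intro ρ σ; rfl
  | app t u iht ihu => intro ρ σ; simp only [rename, subst, iht, ihu]
  | lam t ih =>
    intro ρ σ
    simp only [rename, subst, ih]
    rw [subst_congr t]
    rintro (_ | n)
    · rfl
    · simp only [up, rename_rename]; rfl

theorem subst_subst (t : Tm) :
    ∀ σ τ : ℕ → Tm, subst σ (subst τ t) = subst (fun n => subst σ (τ n)) t := by
  induction t with
  | var n => intro σ τ; rfl
  | app t u iht ihu => intro σ τ; simp only [subst, iht, ihu]
  | lam t ih =>
    intro σ τ
    simp only [subst, ih]
    rw [subst_congr t]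
    rintro (_ | n)
    · rfl
    · simp only [up, subst_rename, rename_subst]

theorem inst_subst_up (t u : Tm) (σ : ℕ → Tm) :
    inst (subst (up σ) t) u = subst (consVal u σ) t := by
  rw [inst, subst_subst]
  refine subst_congr t ?_
  rintro (_ | n)
  · rfl
  · simp only [up, subst_rename, consVal]; exact subst_var _

theorem rename_inst (t u : Tm) (ρ : ℕ → ℕ) :
    rename ρ (inst t u) = inst (rename (upRen ρ) t) (rename ρ u) := by
  rw [inst, inst, rename_subst, subst_rename]
  refine subst_congr t ?_
  rintro (_ | n) <;> rfl

theorem inst_var_eq_rename (t : Tm) (x : ℕ) : inst t (var x) = rename (consVal x fun n => n) t := by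
  rw [inst, rename_eq_subst]
  refine subst_congr t ?_
  rintro (_ | n) <;> rfl

theorem Occurs.of_rename {t : Tm} : ∀ {n : ℕ} {ρ : ℕ → ℕ},
    Occurs n (rename ρ t) → ∃ m, Occurs m t ∧ n = ρ m := by
  induction t with
  | var k => intro n ρ h; exact ⟨k, rfl, h⟩
  | app t u iht ihu =>
    rintro n ρ (h | h)
    · obtain ⟨m, hm, e⟩ := iht h; exact ⟨m, Or.inl hm, e⟩
    · obtain ⟨m, hm, e⟩ := ihu h; exact ⟨m, Or.inr hm, e⟩
  | lam t ih =>
    intro n ρ h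
    obtain ⟨_ | m, hm, e⟩ := ih h
    · simp [upRen] at e
    · exact ⟨m, hm, by simpa [upRen] using e⟩

theorem Occurs.of_subst {t : Tm} : ∀ {n : ℕ} {σ : ℕ → Tm},
    Occurs n (subst σ t) → ∃ m, Occurs m t ∧ Occurs n (σ m) := by
  induction t with
  | var k => intro n σ h; exact ⟨k, rfl, h⟩
  | app t u iht ihu =>
    rintro n σ (h | h)
    · obtain ⟨m, hm, e⟩ := iht h; exact ⟨m, Or.inl hm, e⟩
    · obtain ⟨m, hm, e⟩ := ihu h; exact ⟨m, Or.inr hm, e⟩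
  | lam t ih =>
    intro n σ h
    obtain ⟨_ | m, hm, e⟩ := ih h
    · simp [up, Occurs] at e
    · obtain ⟨k, hk, e'⟩ := Occurs.of_rename e
      obtain rfl : n = k := Nat.succ_injective e'
      exact ⟨m, hm, hk⟩

theorem BetaStep.occurs {t t' : Tm} (h : BetaStep t t') : ∀ {n : ℕ}, Occurs n t' → Occurs n t := by
  induction h with
  | beta u v =>
    intro n hn
    obtain ⟨_ | m, hm, e⟩ := Occurs.of_subst hn
    · exact Or.inr e
    · obtain rfl : n = m := e
      exact Or.inl hm
  | appLeft u _ ih => exact fun hn => hn.imp_left ih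
  | appRight t _ ih => exact fun hn => hn.imp_right ih
  | lam _ ih => exact fun hn => ih hn

theorem BetaRed.occurs {t t' : Tm} (h : BetaRed t t') {n : ℕ} (hn : Occurs n t') : Occurs n t := by
  induction h with
  | refl => exact hn
  | tail _ hs ih => exact ih (hs.occurs hn)

theorem BetaStep.rename {t t' : Tm} (h : BetaStep t t') :
    ∀ ρ : ℕ → ℕ, BetaStep (t.rename ρ) (t'.rename ρ) := by
  induction h with
  | beta u v => intro ρ; rw [rename_inst]; exact .beta _ _
  | appLeft u _ ih => exact fun ρ => .appLeft _ (ih ρ)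
  | appRight t _ ih => exact fun ρ => .appRight _ (ih ρ)
  | lam _ ih => exact fun ρ => .lam (ih _)

theorem BetaRed.rename {t t' : Tm} (h : BetaRed t t') (ρ : ℕ → ℕ) :
    BetaRed (t.rename ρ) (t'.rename ρ) :=
  Relation.ReflTransGen.lift _ (fun _ _ hs => hs.rename ρ) _ _ h

theorem BetaRed.lam {t t' : Tm} (h : BetaRed t t') : BetaRed (Tm.lam t) (Tm.lam t') :=
  Relation.ReflTransGen.lift Tm.lam (fun _ _ => BetaStep.lam) _ _ h

theorem BetaRed.appLeft {t t' : Tm} (h : BetaRed t t') (u : Tm) :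
    BetaRed (app t u) (app t' u) :=
  Relation.ReflTransGen.lift (fun s => app s u) (fun _ _ => BetaStep.appLeft u) _ _ h

theorem BetaRed.appRight (t : Tm) {u u' : Tm} (h : BetaRed u u') :
    BetaRed (app t u) (app t u') :=
  Relation.ReflTransGen.lift (app t) (fun _ _ => BetaStep.appRight t) _ _ h

/-- The argument is a variable and never reduces, so either the outer application survives or its
head redex is contracted at some stage. -/
theorem BetaRed.app_var {t s : Tm} {x : ℕ} (h : BetaRed (app t (var x)) s) :
    (∃ t', BetaRed t t' ∧ s = app t' (var x)) ∨
      ∃ u, BetaRed t (Tm.lam u) ∧ BetaRed (inst u (var x)) s := by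
  induction h with
  | refl => exact Or.inl ⟨t, .refl, rfl⟩
  | tail _ hs ih =>
    rcases ih with ⟨t', ht, rfl⟩ | ⟨u, hu, hr⟩
    · cases hs with
      | beta u v => exact Or.inr ⟨u, ht, .refl⟩
      | appLeft _ h => exact Or.inl ⟨_, ht.tail h, rfl⟩
      | appRight _ h => cases h
    · exact Or.inr ⟨u, hu, hr.tail hs⟩

/-- The renaming that turns the variable `x` into the variable about to be bound. -/
def capture (x : ℕ) (n : ℕ) : ℕ := if n = x then 0 else n + 1

/-- Instantiation by a fresh variable loses nothing: binding that variable again recovers the body.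
-/
theorem rename_capture_inst {u : Tm} {x : ℕ} (hx : ¬ Occurs x (lam u)) :
    rename (capture x) (inst u (var x)) = u := by
  rw [inst_var_eq_rename, rename_rename]
  conv_rhs => rw [← rename_id u]
  refine rename_congr u ?_
  rintro (_ | n) hn
  · simp [consVal, capture]
  · have : n ≠ x := by rintro rfl; exact hx hn
    simp [consVal, capture, this]

end Tm

-- Renaming, properness and values of types

namespace Ty

variable {C : Type*}

/-- A strict upper bound of the free variables of a type. -/
def bound : Ty C → ℕ
  | var n => n + 1
  | const _ => 0
  | arr A B => max (bound A) (bound B)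
  | all A => bound A

theorem Occurs.lt_bound {A : Ty C} : ∀ {n : ℕ}, Occurs n A → n < bound A := by
  induction A with
  | var m => rintro n rfl; exact Nat.lt_succ_self _
  | const c => rintro n ⟨⟩
  | arr A B ihA ihB =>
    rintro n (h | h)
    · exact lt_max_of_lt_left (ihA h)
    · exact lt_max_of_lt_right (ihB h)
  | all A ih => intro n h; exact (Nat.lt_succ_self n).trans (ih h)

theorem rename_congr (A : Ty C) :
    ∀ {ρ ρ' : ℕ → ℕ}, (∀ n, Occurs n A → ρ n = ρ' n) → rename ρ A = rename ρ' A := by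
  induction A with
  | var m => intro ρ ρ' h; simp only [rename, h m rfl]
  | const c => intro ρ ρ' _; rfl
  | arr A B ihA ihB =>
    intro ρ ρ' h
    simp only [rename, ihA fun n hn => h n (Or.inl hn), ihB fun n hn => h n (Or.inr hn)]
  | all A ih =>
    intro ρ ρ' h
    simp only [rename]
    rw [ih]
    rintro (_ | n) hn
    · rfl
    · exact congrArg Nat.succ (h n hn)

theorem rename_rename (A : Ty C) : ∀ ρ ρ' : ℕ → ℕ,
    rename ρ (rename ρ' A) = rename (fun n => ρ (ρ' n)) A := by
  induction A with
  | var m => intro ρ ρ'; rfl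
  | const c => intro ρ ρ'; rfl
  | arr A B ihA ihB => intro ρ ρ'; simp only [rename, ihA, ihB]
  | all A ih =>
    intro ρ ρ'
    simp only [rename, ih]
    rw [rename_congr A fun n _ => upRen_comp ρ ρ' n]

theorem rename_id_of_closed {A : Ty C} (hA : A.Closed) (ρ : ℕ → ℕ) : rename ρ A = A := by
  have id_eq : ∀ B : Ty C, rename (fun n => n) B = B := by
    intro B
    induction B with
    | var m => rfl
    | const c => rfl
    | arr A B ihA ihB => simp only [rename, ihA, ihB]
    | all A ih =>
      simp only [rename]
      rw [rename_congr A (ρ' := fun n => n) (by rintro (_ | n) _ <;> rfl), ih]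
  conv_rhs => rw [← id_eq A]
  exact rename_congr A fun n hn => absurd hn (hA n)

theorem occurs_rename {A : Ty C} : ∀ {n : ℕ} {ρ : ℕ → ℕ},
    Occurs n (rename ρ A) ↔ ∃ m, Occurs m A ∧ n = ρ m := by
  induction A with
  | var k => intro n ρ; simp [rename, Occurs]
  | const c => intro n ρ; simp [rename, Occurs]
  | arr A B ihA ihB => intro n ρ; simp only [rename, Occurs, ihA, ihB, or_and_right, exists_or]
  | all A ih =>
    intro n ρ
    simp only [rename, Occurs, ih]
    constructor
    · rintro ⟨_ | m, hm, e⟩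
      · simp [upRen] at e
      · exact ⟨m, hm, by simpa [upRen] using e⟩
    · rintro ⟨m, hm, rfl⟩
      exact ⟨m + 1, hm, rfl⟩

theorem Proper.rename {A : Ty C} : A.Proper → ∀ ρ : ℕ → ℕ, (A.rename ρ).Proper := by
  induction A with
  | var m => exact fun _ _ => trivial
  | const c => exact fun _ _ => trivial
  | arr A B ihA ihB => exact fun h ρ => ⟨ihA h.1 ρ, ihB h.2 ρ⟩
  | all A ih => exact fun h ρ => ⟨occurs_rename.2 ⟨0, h.1, rfl⟩, ih h.2 _⟩

/-- A countable set of types that contains the renamings of the subexpressions of a type. -/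
def instances : Ty C → Set (Ty C)
  | var _ => Set.range var
  | const c => {const c}
  | arr A B => Set.image2 arr (instances A) (instances B) ∪ (instances A ∪ instances B)
  | all A => all '' instances A ∪ instances A

theorem countable_instances (A : Ty C) : (instances A).Countable := by
  induction A with
  | var m => exact Set.countable_range _
  | const c => exact Set.countable_singleton _
  | arr A B ihA ihB => exact (ihA.image2 ihB _).union (ihA.union ihB)
  | all A ih => exact (ih.image _).union ih

theorem rename_mem_instances (A : Ty C) : ∀ ρ : ℕ → ℕ, rename ρ A ∈ instances A := by
  induction A with
  | var m => exact fun ρ => ⟨ρ m, rfl⟩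
  | const c => exact fun ρ => rfl
  | arr A B ihA ihB => exact fun ρ => Or.inl ⟨_, ihA ρ, _, ihB ρ, rfl⟩
  | all A ih => exact fun ρ => Or.inl ⟨_, ih _, rfl⟩

theorem val_rename (M : BetaModel C) (A : Ty C) : ∀ (ρ : ℕ → ℕ) (I : ℕ → M.R),
    (rename ρ A).val M I = A.val M fun n => I (ρ n) := by
  induction A with
  | var m => intro ρ I; rfl
  | const c => intro ρ I; rfl
  | arr A B ihA ihB => intro ρ I; simp only [rename, val, ihA, ihB]
  | all A ih =>
    intro ρ I
    simp only [rename, val, ih]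
    refine Set.iInter_congr fun Φ => val_congr M A _ _ ?_
    rintro (_ | n) _ <;> rfl

theorem val_subst (M : BetaModel C) (A : Ty C) : ∀ (σ : ℕ → Ty C) (I : ℕ → M.R),
    (subst σ A).val M I = A.val M fun n => ⟨(σ n).val M I, val_mem M _ I⟩ := by
  induction A with
  | var m => intro σ I; rfl
  | const c => intro σ I; rfl
  | arr A B ihA ihB => intro σ I; simp only [subst, val, ihA, ihB]
  | all A ih =>
    intro σ I
    simp only [subst, val, ih]
    refine Set.iInter_congr fun Φ => val_congr M A _ _ ?_
    rintro (_ | n) _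
    · rfl
    · exact Subtype.ext (val_rename M (σ n) _ _)

theorem val_inst (M : BetaModel C) (A F : Ty C) (I : ℕ → M.R) :
    (A.inst F).val M I = A.val M (consVal ⟨F.val M I, val_mem M F I⟩ I) := by
  rw [inst, val_subst]
  refine val_congr M A _ _ ?_
  rintro (_ | n) _ <;> rfl

end Ty

-- Soundness

variable {C : Type*}

/-- The typing rules are sound for the interpretation in `Λ_β`-models. -/
theorem Typing.subst_mem_val (M : BetaModel C) {Γ : Ctx C} {t : Tm} {A : Ty C}
    (h : Typing Γ t A) : ∀ (I : ℕ → M.R) (σ : ℕ → Tm),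
      (∀ n B, Γ n = some B → σ n ∈ B.val M I) → t.subst σ ∈ A.val M I := by
  induction h with
  | var h => exact fun I σ hσ => hσ _ _ h
  | @lam Γ t A B _ ih =>
    intro I σ hσ u hu
    refine M.adequate.saturated _ (Ty.val_mem M B I) _ _ (ih I (consVal u σ) ?_)
      (.single (Tm.inst_subst_up t u σ ▸ .beta _ _))
    rintro (_ | n) D hD
    · obtain rfl : A = D := Option.some.inj hD
      exact hu
    · exact hσ n D hD
  | app _ _ ihu ihv => exact fun I σ hσ => ihu I σ hσ _ (ihv I σ hσ)
  | gen _ ih =>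
    intro I σ hσ
    refine Set.mem_iInter.2 fun Φ => ih _ σ fun n B hB => ?_
    obtain ⟨D, hD, rfl⟩ := Option.map_eq_some_iff.1 hB
    rw [Ty.val_rename]
    exact hσ n D hD
  | inst F _ ih =>
    intro I σ hσ
    rw [Ty.val_inst]
    exact Set.mem_iInter.1 (ih I σ hσ) _

-- Typing of normal terms without instantiation

/-- Normal and neutral terms, the latter being the applications of a variable. -/
inductive NormalKind : Type
  | neutral : NormalKind
  | normal : NormalKind

/-- Typing derivations of normal terms, without elimination of quantifiers. -/
inductive NormalTyping : NormalKind → Ctx C → Tm → Ty C → Prop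
  | var {Γ : Ctx C} {n : ℕ} {A : Ty C} : Γ n = some A → NormalTyping .neutral Γ (Tm.var n) A
  | app {Γ : Ctx C} {u v : Tm} {A B : Ty C} :
      NormalTyping .neutral Γ u (Ty.arr A B) → NormalTyping .normal Γ v A →
        NormalTyping .neutral Γ (Tm.app u v) B
  | ofNeutral {Γ : Ctx C} {t : Tm} {A : Ty C} :
      NormalTyping .neutral Γ t A → NormalTyping .normal Γ t A
  | lam {Γ : Ctx C} {t : Tm} {A B : Ty C} :
      NormalTyping .normal (Ctx.cons A Γ) t B → NormalTyping .normal Γ (Tm.lam t) (Ty.arr A B)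
  | gen {Γ : Ctx C} {t : Tm} {A : Ty C} :
      NormalTyping .normal (Ctx.shift Γ) t A → NormalTyping .normal Γ t (Ty.all A)

/-- The context whose types are renamed. -/
def Ctx.mapRename (θ : ℕ → ℕ) (Γ : Ctx C) : Ctx C := fun n => (Γ n).map (Ty.rename θ)

theorem Ctx.mapRename_cons (θ : ℕ → ℕ) (A : Ty C) (Γ : Ctx C) :
    Ctx.mapRename θ (Ctx.cons A Γ) = Ctx.cons (A.rename θ) (Ctx.mapRename θ Γ) := by
  funext n
  cases n <;> rfl

theorem Ctx.mapRename_shift (θ : ℕ → ℕ) (Γ : Ctx C) :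
    Ctx.mapRename (upRen θ) (Ctx.shift Γ) = Ctx.shift (Ctx.mapRename θ Γ) := by
  funext n
  simp only [Ctx.mapRename, Ctx.shift, Option.map_map]
  congr 1
  funext A
  simp only [Function.comp, Ty.rename_rename]
  rfl

namespace NormalTyping

variable {k : NormalKind} {Γ : Ctx C} {t : Tm} {A : Ty C}

theorem typing (h : NormalTyping k Γ t A) : Typing Γ t A := by
  induction h with
  | var h => exact .var h
  | app _ _ ihu ihv => exact .app ihu ihv
  | ofNeutral _ ih => exact ih
  | lam _ ih => exact .lam ih
  | gen _ ih => exact .gen ih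

/-- Agreement is required only on the free variables of `t`, so this covers both passing to a
smaller context and turning a variable of the context into a bound one. -/
theorem rename (h : NormalTyping k Γ t A) : ∀ {Δ : Ctx C} {ρ : ℕ → ℕ},
    (∀ n, t.Occurs n → Δ (ρ n) = Γ n) → NormalTyping k Δ (t.rename ρ) A := by
  induction h with
  | @var Γ n A h => exact fun hΔ => .var ((hΔ n rfl).trans h)
  | app _ _ ihu ihv =>
    exact fun hΔ => .app (ihu fun n hn => hΔ n (Or.inl hn)) (ihv fun n hn => hΔ n (Or.inr hn))
  | ofNeutral _ ih => exact fun hΔ => .ofNeutral (ih hΔ)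
  | lam _ ih =>
    intro Δ ρ hΔ
    refine .lam (ih ?_)
    rintro (_ | n) hn
    · rfl
    · exact hΔ n hn
  | gen _ ih =>
    intro Δ ρ hΔ
    refine .gen (ih fun n hn => ?_)
    simp only [Ctx.shift, hΔ n hn]

theorem congr_ctx {Δ : Ctx C} (h : NormalTyping k Γ t A) (hΔ : ∀ n, t.Occurs n → Δ n = Γ n) :
    NormalTyping k Δ t A :=
  t.rename_id ▸ h.rename (ρ := fun n => n) hΔ

theorem mapRename (h : NormalTyping k Γ t A) : ∀ θ : ℕ → ℕ,
    NormalTyping k (Ctx.mapRename θ Γ) t (A.rename θ) := by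
  induction h with
  | var h => intro θ; exact .var (by rw [Ctx.mapRename, h]; rfl)
  | app _ _ ihu ihv => exact fun θ => .app (ihu θ) (ihv θ)
  | ofNeutral _ ih => exact fun θ => .ofNeutral (ih θ)
  | lam _ ih => exact fun θ => .lam (Ctx.mapRename_cons θ _ _ ▸ ih θ)
  | gen _ ih => exact fun θ => .gen (Ctx.mapRename_shift θ _ ▸ ih (upRen θ))

/-- Without instantiation, the type of a neutral term is a subexpression of a type of the context.
-/
theorem proper_of_neutral (h : NormalTyping .neutral Γ t A)
    (hΓ : ∀ n B, Γ n = some B → B.Proper) : A.Proper := by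
  generalize hk : NormalKind.neutral = k at h
  induction h with
  | var h => exact hΓ _ _ h
  | app _ _ ihu _ => exact (ihu hΓ hk).2
  | _ => cases hk

/-- The types of the terms that are not abstractions have only the free variables of the context. -/
theorem not_occurs (h : NormalTyping k Γ t A) : (∀ s, t ≠ Tm.lam s) → ∀ {m : ℕ},
    (∀ n B, Γ n = some B → ¬ B.Occurs m) → ¬ A.Occurs m := by
  induction h with
  | var h => exact fun _ _ hΓ => hΓ _ _ h
  | @app Γ u v A B hu _ ihu _ =>
    exact fun _ _ hΓ hm => ihu (by rintro s rfl; cases hu) hΓ (Or.inr hm)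
  | ofNeutral _ ih => exact ih
  | lam _ _ => exact fun ht => absurd rfl (ht _)
  | gen _ ih =>
    intro ht m hΓ
    refine ih ht (m := m + 1) fun n B hB hm => ?_
    obtain ⟨D, hD, rfl⟩ := Option.map_eq_some_iff.1 hB
    obtain ⟨m', hm', e⟩ := Ty.occurs_rename.1 hm
    obtain rfl : m = m' := Nat.succ_injective e
    exact hΓ n D hD hm'

/-- Only the quantifiers that bind nothing can be introduced on a term that is not an
abstraction. -/
theorem neutral_of_proper (h : NormalTyping k Γ t A) (ht : ∀ s, t ≠ Tm.lam s) (hA : A.Proper) :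
    NormalTyping .neutral Γ t A := by
  cases h with
  | var h => exact .var h
  | app hu hv => exact .app hu hv
  | ofNeutral h => exact h
  | lam _ => exact absurd rfl (ht _)
  | gen h =>
    refine absurd hA.1 (h.not_occurs ht fun n B hB h0 => ?_)
    obtain ⟨D, _, rfl⟩ := Option.map_eq_some_iff.1 hB
    obtain ⟨m, _, e⟩ := Ty.occurs_rename.1 h0
    cases e

/-- Both types are proper, so no vacuous generalization can be hidden above the application or above
its argument `x`; the type of `x` is then the one read in `Γ`. -/
theorem of_app_var {x : ℕ} {B : Ty C} (hΓ : ∀ n B, Γ n = some B → B.Proper)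
    (hx : Γ x = some B) (hA : A.Proper)
    (h : NormalTyping k Γ (Tm.app t (Tm.var x)) A) : NormalTyping .neutral Γ t (Ty.arr B A) := by
  cases h.neutral_of_proper (by rintro s ⟨⟩) hA with
  | app hu hv =>
    cases hv.neutral_of_proper (by rintro s ⟨⟩) (hu.proper_of_neutral hΓ).1 with
    | var h' =>
      obtain rfl := Option.some.inj (hx.symm.trans h')
      exact hu

end NormalTyping

-- The model built from neutral terms

/-- The terms that reduce to a normal (resp. neutral) term of the given type. -/
def normalizing (k : NormalKind) (Γ : Ctx C) (A : Ty C) : Set Tm :=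
  {t | ∃ s, Tm.BetaRed t s ∧ NormalTyping k Γ s A}

theorem isSaturated_normalizing (k : NormalKind) (Γ : Ctx C) (A : Ty C) :
    IsSaturated (normalizing k Γ A) := by
  rintro t u ⟨s, hs, h⟩ htu
  exact ⟨s, htu.trans hs, h⟩

/-- The set of all saturated sets is adequate. -/
theorem isAdequate_isSaturated : IsAdequate {G : Set Tm | IsSaturated G} where
  saturated _ h := h
  arrow_mem _ _ _ hG' _ _ hu htu v hv := hG' _ _ (hu v hv) (htu.appLeft v)
  sInter_mem _ hσ _ _ hu htu G hG := hσ hG _ _ (hu G hG) htu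

/-- The model of all saturated sets, where the constants are interpreted by neutral terms. -/
def neutralModel (Γ : Ctx C) : BetaModel C where
  R := {G | IsSaturated G}
  adequate := isAdequate_isSaturated
  const c := ⟨normalizing .neutral Γ (.const c), isSaturated_normalizing _ _ _⟩

/-- The interpretation of the variables of index `n` by neutral terms of type `ρ n`. -/
def neutralVal (Γ : Ctx C) (ρ : ℕ → ℕ) : ℕ → (neutralModel Γ).R := fun n =>
  ⟨normalizing .neutral Γ (.var (ρ n)), isSaturated_normalizing _ _ _⟩

theorem consVal_neutralVal (Γ : Ctx C) (ρ : ℕ → ℕ) (m : ℕ) :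
    consVal (neutralVal Γ (fun _ => m) 0) (neutralVal Γ ρ) = neutralVal Γ (consVal m ρ) := by
  funext n
  cases n <;> rfl

theorem normalizing_neutral_subset (Γ : Ctx C) (A : Ty C) :
    normalizing .neutral Γ A ⊆ normalizing .normal Γ A :=
  fun _ ⟨s, hs, h⟩ => ⟨s, hs, .ofNeutral h⟩

/-- If the application to the fresh `x` survives reduction, its function part is neutral of the
arrow type. Otherwise `t` reduces to an abstraction, and abstracting `x` in the reduct gives the
required term. -/
theorem mem_normalizing_arr {Γ : Ctx C} (hΓ : ∀ n B, Γ n = some B → B.Proper) {A B : Ty C}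
    (hB : B.Proper) {t : Tm} {x : ℕ} (hx : Γ x = some A) (hxt : ¬ t.Occurs x)
    (h : Tm.app t (Tm.var x) ∈ normalizing .normal Γ B) :
    t ∈ normalizing .normal Γ (.arr A B) := by
  obtain ⟨s, hs, h⟩ := h
  rcases hs.app_var with ⟨t', ht, rfl⟩ | ⟨u, hu, hr⟩
  · exact ⟨t', ht, .ofNeutral (h.of_app_var hΓ hx hB)⟩
  · have hr' := hr.rename (Tm.capture x)
    rw [Tm.rename_capture_inst fun hxu => hxt (hu.occurs hxu)] at hr'
    refine ⟨_, hu.trans hr'.lam, .lam (h.rename fun n _ => ?_)⟩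
    by_cases hn : n = x
    · simp [Tm.capture, hn, hx, Ctx.cons]
    · simp [Tm.capture, hn, Ctx.cons]

theorem mem_normalizing_all {Γ : Ctx C} {A : Ty C} {ρ : ℕ → ℕ} {t : Tm} {m : ℕ}
    (hm : ∀ n, A.Occurs (n + 1) → ρ n ≠ m)
    (hmt : ∀ n B, t.Occurs n → Γ n = some B → ¬ B.Occurs m)
    (h : t ∈ normalizing .normal Γ (A.rename (consVal m ρ))) :
    t ∈ normalizing .normal Γ (.all (A.rename (upRen ρ))) := by
  obtain ⟨s, hs, h⟩ := h
  refine ⟨s, hs, .gen ?_⟩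
  -- The index map is used here on type variables: `m` becomes the quantified variable, and on the
  -- types of the context, which avoid `m`, it is a mere shift.
  have h' := h.mapRename (Tm.capture m)
  rw [Ty.rename_rename, Ty.rename_congr A (ρ' := upRen ρ)] at h'
  · refine h'.congr_ctx fun n hn => ?_
    cases hB : Γ n with
    | none => simp [Ctx.shift, Ctx.mapRename, hB]
    | some B =>
      simp only [Ctx.shift, Ctx.mapRename, hB, Option.map_some]
      refine congrArg some (Ty.rename_congr B fun i hi => ?_)
      have : i ≠ m := by rintro rfl; exact hmt n B (hs.occurs hn) hB hi
      simp [Tm.capture, this]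
  · rintro (_ | n) hn
    · simp [consVal, Tm.capture, upRen]
    · simp [consVal, Tm.capture, upRen, hm n hn]

theorem exists_fresh (Γ : Ctx C) (A : Ty C) (ρ : ℕ → ℕ) (t : Tm) :
    ∃ m, (∀ n, A.Occurs (n + 1) → ρ n ≠ m) ∧
      ∀ n B, t.Occurs n → Γ n = some B → ¬ B.Occurs m := by
  let f : ℕ → ℕ := fun n => (Γ n).elim 0 Ty.bound
  refine ⟨max ((Finset.range A.bound).sup ρ + 1) ((Finset.range t.bound).sup f), ?_, ?_⟩
  · intro n hn e
    have h : ρ n ≤ (Finset.range A.bound).sup ρ :=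
      Finset.le_sup (Finset.mem_range.2 ((Nat.lt_succ_self n).trans hn.lt_bound))
    omega
  · intro n B hn hB hm
    have h : f n ≤ (Finset.range t.bound).sup f := Finset.le_sup (Finset.mem_range.2 hn.lt_bound)
    have hf : f n = B.bound := by simp [f, hB]
    have := hm.lt_bound
    omega

/-- The two inclusions need each other: an arrow exchanges polarities on its left. The renaming `ρ`
is arbitrary because each quantifier is opened with a fresh type variable. -/
theorem val_neutralModel {Γ : Ctx C} (hΓ : ∀ n B, Γ n = some B → B.Proper) (A : Ty C) :
    A.Proper →
    (∀ B ∈ A.instances, B.Proper → ∀ k, ∃ x ≥ k, Γ x = some B) → ∀ ρ : ℕ → ℕ,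
      (A.IsForallPos →
        A.val (neutralModel Γ) (neutralVal Γ ρ) ⊆ normalizing .normal Γ (A.rename ρ)) ∧
      (A.IsForallNeg →
        normalizing .neutral Γ (A.rename ρ) ⊆ A.val (neutralModel Γ) (neutralVal Γ ρ)) := by
  induction A with
  | var n => exact fun _ _ ρ => ⟨fun _ => normalizing_neutral_subset Γ _, fun _ => subset_rfl⟩
  | const c => exact fun _ _ ρ => ⟨fun _ => normalizing_neutral_subset Γ _, fun _ => subset_rfl⟩
  | arr A B ihA ihB =>
    intro hp hs ρ
    have ihA := ihA hp.1 (fun D hD => hs D (Or.inr (Or.inl hD))) ρ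
    have ihB := ihB hp.2 (fun D hD => hs D (Or.inr (Or.inr hD))) ρ
    constructor
    · intro hpos t ht
      rw [Ty.IsForallPos] at hpos
      obtain ⟨x, hxt, hx⟩ := hs _ (Or.inr (Or.inl (A.rename_mem_instances ρ))) (hp.1.rename ρ)
        t.bound
      -- The fresh variable `x` is itself neutral, hence lies in the value of the `∀₂⁻` domain.
      exact mem_normalizing_arr hΓ (hp.2.rename ρ) hx (fun h => absurd h.lt_bound hxt.not_gt)
        (ihB.1 hpos.2 (ht _ (ihA.2 hpos.1 ⟨_, .refl, .var hx⟩)))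
    · rintro hneg t ⟨t', ht, h⟩ u hu
      rw [Ty.IsForallNeg] at hneg
      obtain ⟨u', hu', h'⟩ := ihA.1 hneg.1 hu
      exact ihB.2 hneg.2 ⟨_, (ht.appLeft u).trans (hu'.appRight t'), .app h h'⟩
  | all A ih =>
    intro hp hs ρ
    have ih := ih hp.2 fun D hD => hs D (Or.inr hD)
    constructor
    · intro hpos t ht
      rw [Ty.IsForallPos] at hpos
      obtain ⟨m, hm, hmt⟩ := exists_fresh Γ A ρ t
      -- The bound variable takes as value the neutral interpretation of the fresh type variable
      -- `m`.
      have ht := Set.mem_iInter.1 ht (neutralVal Γ (fun _ => m) 0)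
      rw [consVal_neutralVal] at ht
      exact mem_normalizing_all hm hmt ((ih _).1 hpos ht)
    · intro hneg
      rw [Ty.IsForallNeg] at hneg
      -- A `∀₂⁻` quantifier binds nothing, which properness forbids.
      exact absurd hp.1 hneg.1

/-- A context that avoids finitely many variables and assigns each type of a countable set to
infinitely many variables. -/
theorem exists_ctx {T : Set (Ty C)} (hT : T.Countable) (k : ℕ) :
    ∃ Γ : Ctx C, (∀ n < k, Γ n = none) ∧ (∀ n B, Γ n = some B → B ∈ T) ∧
      ∀ B ∈ T, ∀ m, ∃ x ≥ m, Γ x = some B := by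
  rcases T.eq_empty_or_nonempty with rfl | hne
  · exact ⟨fun _ => none, fun _ _ => rfl, fun _ _ h => absurd h (Option.some_ne_none _).symm, fun _ hB => absurd hB (Set.notMem_empty _)⟩
  obtain ⟨g, rfl⟩ := hT.exists_eq_range hne
  -- The first component of the pairing selects the type; the second is free, so each type recurs at
  -- arbitrarily large indices.
  refine ⟨fun n => if n < k then none else some (g n.unpair.1), fun n hn => if_pos hn, ?_, ?_⟩
  · intro n B h
    dsimp only at h
    split_ifs at h
    exact ⟨_, Option.some.inj h⟩
  · rintro _ ⟨i, rfl⟩ m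
    have h := Nat.right_le_pair i (max m k)
    refine ⟨Nat.pair i (max m k), (le_max_left m k).trans h, ?_⟩
    simp only [Nat.unpair_pair, if_neg ((le_max_right m k).trans h).not_gt]

theorem exists_typing_of_mem_betaVal {A : Ty C} (hpos : A.IsForallPos) (hclosed : A.Closed)
    (hproper : A.Proper) {t : Tm} (ht : t ∈ A.betaVal) :
    ∃ t', Tm.BetaRed t t' ∧ Typing Ctx.empty t' A := by
  obtain ⟨Γ, hfree, hΓ, hs⟩ :=
    exists_ctx (A.countable_instances.mono (Set.inter_subset_left (t := {B | B.Proper}))) t.bound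
  have hv := Set.mem_iInter₂.1 ht (neutralModel Γ) (neutralVal Γ fun n => n)
  obtain ⟨t', htt', h⟩ := (val_neutralModel (fun n B hB => (hΓ n B hB).2) A hproper
    (fun B hB hp => hs B ⟨hB, hp⟩) _).1 hpos hv
  rw [Ty.rename_id_of_closed hclosed] at h
  exact ⟨t', htt', (h.congr_ctx fun n hn => (hfree n (htt'.occurs hn).lt_bound).symm).typing⟩

theorem mem_betaVal_of_typing {A : Ty C} {t t' : Tm} (ht : Tm.BetaRed t t')
    (h : Typing Ctx.empty t' A) : t ∈ A.betaVal := by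
  refine Set.mem_iInter₂.2 fun M I => M.adequate.saturated _ (Ty.val_mem M A I) _ _ ?_ ht
  have := h.subst_mem_val M I Tm.var fun _ _ hn => by cases hn
  rwa [Tm.subst_var] at this

end SystemF

theorem mainTheorem7 {C : Type*} (A : SystemF.Ty C) (hpos : A.IsForallPos)
    (hclosed : A.Closed) (hproper : A.Proper) (t : SystemF.Tm) :
    t ∈ A.betaVal ↔
      ∃ t' : SystemF.Tm, SystemF.Tm.BetaRed t t' ∧ SystemF.Typing SystemF.Ctx.empty t' A :=
  ⟨SystemF.exists_typing_of_mem_betaVal hpos hclosed hproper,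
    fun ⟨_, ht, h⟩ => SystemF.mem_betaVal_of_typing ht h⟩
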